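/- Let $k$ be a perfect field of prime characteristic $p>0$, let $n\ge 1$, let $R=k[[X_1,\dots,X_{n+1}]]$ with maximal ideal $\mathfrak m=(X_1,\dots,X_{n+1})$, and let $0\ne f\in\mathfrak m$. For an ideal $I$ of a commutative ring and $q\ge 1$, let $I^{[q]}$ denote the ideal generated by the $q$-th powers of all elements of $I$. For a Noetherian local ring $(A,\mathfrak n)$ of characteristic $p$ and Krull dimension $d$, let $$e_{HK}(A)=\lim_{e\to\infty}\frac{\ell_A\bigl(A/\mathfrak n^{[p^e]}\bigr)}{p^{ed}}$$ be its Hilbert--Kunz multiplicity, where $\ell_A$ denotes length, and let $$\mathrm{fpt}(f)=\lim_{e\to\infty}\frac{\mu_f(p^e)}{p^e},\qquad \mu_f(p^e)=\min\{t\ge 1 : f^t\in\mathfrak m^{[p^e]}\},$$ be the F-pure threshold of $f$. Then the limits defining $e_{HK}(R/(f))$ and $\mathrm{fpt}(f)$ exist in $\mathbb R$, and $$e_{HK}(R/(f))\cdot \mathrm{fpt}(f)\ \ge\ 1 .$$ -/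

import Mathlib

open Filter Topology

noncomputable section

/-- The Frobenius (bracket) power `I^{[q]}`: the ideal generated by the `q`-th powers of
all elements of `I`. -/
def frobeniusPower {A : Type*} [CommRing A] (I : Ideal A) (q : ℕ) : Ideal A :=
  Ideal.span {y : A | ∃ x ∈ I, y = x ^ q}

/-- The Krull dimension of a Noetherian local ring, as a natural number (it is finite and
nonnegative for such rings). -/
def localDim (A : Type*) [CommRing A] [IsLocalRing A] [IsNoetherianRing A] : ℕ :=
  ((ringKrullDim A).unbotD 0).toNat

/-- The `e`-th normalized Hilbert-Kunz number `ℓ(A / 𝔫^{[p^e]}) / p^{ed}` of a Noetherian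
local ring `(A, 𝔫)` of dimension `d` (the length is finite in characteristic `p`, since
`𝔫^{[p^e]}` is `𝔫`-primary). -/
def hilbertKunzSeq (p : ℕ) (A : Type*) [CommRing A] [IsLocalRing A] [IsNoetherianRing A]
    (e : ℕ) : ℝ :=
  ((Module.length A (A ⧸ frobeniusPower (IsLocalRing.maximalIdeal A) (p ^ e))).toNat : ℝ) /
    (p : ℝ) ^ (e * localDim A)

/-- The Hilbert-Kunz multiplicity `e_HK(A) = lim_e ℓ(A / 𝔫^{[p^e]}) / p^{ed}`. -/
def hilbertKunzMultiplicity (p : ℕ) (A : Type*) [CommRing A] [IsLocalRing A]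
    [IsNoetherianRing A] : ℝ :=
  limUnder atTop (hilbertKunzSeq p A)

/-- `μ_f(q) = min {t ≥ 1 | f^t ∈ 𝔪^{[q]}}`. For `f ∈ 𝔪` and `q ≥ 1` the set contains `q`. -/
def frobeniusOrder {A : Type*} [CommRing A] [IsLocalRing A] (f : A) (q : ℕ) : ℕ :=
  sInf {t : ℕ | 1 ≤ t ∧ f ^ t ∈ frobeniusPower (IsLocalRing.maximalIdeal A) q}

/-- The sequence `μ_f(p^e) / p^e`. -/
def fptSeq (p : ℕ) {A : Type*} [CommRing A] [IsLocalRing A] (f : A) (e : ℕ) : ℝ :=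
  (frobeniusOrder f (p ^ e) : ℝ) / (p : ℝ) ^ e

/-- The F-pure threshold `fpt(f) = lim_e μ_f(p^e) / p^e`. -/
def fpt (p : ℕ) {A : Type*} [CommRing A] [IsLocalRing A] (f : A) : ℝ :=
  limUnder atTop (fptSeq p f)

/-- The quotient of a local ring by an element of its maximal ideal is local. -/
theorem isLocalRing_quotient_span_singleton {A : Type*} [CommRing A] [IsLocalRing A] {f : A}
    (hf : f ∈ IsLocalRing.maximalIdeal A) : IsLocalRing (A ⧸ Ideal.span {f}) := by
  have h : Ideal.span {f} ≠ ⊤ := by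
    rw [Ne, Ideal.span_singleton_eq_top]
    exact (IsLocalRing.mem_maximalIdeal f).1 hf
  haveI : Nontrivial (A ⧸ Ideal.span {f}) := Ideal.Quotient.nontrivial_iff.mpr h
  exact IsLocalRing.of_surjective' (Ideal.Quotient.mk _) Ideal.Quotient.mk_surjective

end

/-! ### Frobenius powers as ideal extensions -/

section FrobeniusPower

variable {A B : Type*} [CommRing A] [CommRing B]

/-! Put `q = p ^ e`, `N = n + 1`, `L e = ℓ(R / (𝔪^[q] + (f)))` and `μ = μ_f(q)`. Since `f ^ μ ∈
𝔪^[q]`, filtering `R / 𝔪^[q]` by powers of `f` gives at most `μ` layers, each a quotient of `R /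
(𝔪^[q] + (f))`. Hence `q ^ N ≤ μ * L e`; dividing by `q ^ N` gives `1 ≤ (L e / q ^ n) * (μ / q)` for
every `e`, and the limit is the claim.

Both limits exist by monotonicity. Frobenius gives `μ_f(pq) ≤ p * μ_f(q)`, so `μ / q` decreases. For
`L e / q ^ n`, independence of the monomials with exponents below `p` over the `p`-th powers
(`pow_card_mul_length_le`) and the filtration by `f` give `p ^ N * L e ≤ ℓ(R / (𝔪^[pq] + (f ^ p))) ≤
p * L (e + 1)`, so the sequence increases. It is bounded because multiplication by `f` is injective
on a box of monomials only a constant `a` smaller than the full one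
(`length_quotient_sup_span_add_le`): `L e ≤ q ^ N - (q - a) ^ N ≤ N * a * q ^ n`. -/

theorem frobeniusPower_eq_map_iterateFrobenius (p : ℕ) [ExpChar A p] (I : Ideal A) (e : ℕ) :
    frobeniusPower I (p ^ e) = I.map (iterateFrobenius A p e) := by
  unfold frobeniusPower Ideal.map
  congr 1
  ext y
  simp [iterateFrobenius_def, eq_comm]

theorem frobeniusPower_map_of_surjective {φ : A →+* B} (hφ : Function.Surjective φ)
    (I : Ideal A) (q : ℕ) :
    frobeniusPower (I.map φ) q = (frobeniusPower I q).map φ := by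
  unfold frobeniusPower
  rw [Ideal.map_span]
  congr 1
  ext y
  constructor
  · rintro ⟨x, hx, rfl⟩
    obtain ⟨z, hz, rfl⟩ := (Ideal.mem_map_iff_of_surjective φ hφ).1 hx
    exact ⟨z ^ q, ⟨z, hz, rfl⟩, map_pow φ z q⟩
  · rintro ⟨_, ⟨z, hz, rfl⟩, rfl⟩
    exact ⟨φ z, Ideal.mem_map_of_mem φ hz, map_pow φ z q⟩

end FrobeniusPower

/-! ### Length inequalities from partially exact sequences -/

section Length

variable {R : Type*} [Ring R] {M N P : Type*} [AddCommGroup M] [Module R M]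
  [AddCommGroup N] [Module R N] [AddCommGroup P] [Module R P]

theorem Module.length_le_add_of_exact (g : N →ₗ[R] M) (h : M →ₗ[R] P)
    (hh : Function.Surjective h) (hgh : Function.Exact g h) :
    Module.length R M ≤ Module.length R N + Module.length R P := by
  rw [Module.length_eq_add_of_exact (LinearMap.ker h).subtype h (Submodule.subtype_injective _) hh
    (LinearMap.exact_subtype_ker_map h)]
  gcongr
  have hk : LinearMap.range g = LinearMap.ker h := hgh.linearMap_ker_eq.symm
  rw [← hk]
  exact Module.length_le_of_surjective g.rangeRestrict g.surjective_rangeRestrict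

theorem Module.length_add_le_of_comp_eq_zero (g : N →ₗ[R] M) (h : M →ₗ[R] P)
    (hg : Function.Injective g) (hh : Function.Surjective h) (hgh : ∀ x, h (g x) = 0) :
    Module.length R N + Module.length R P ≤ Module.length R M := by
  rw [Module.length_eq_add_of_exact (LinearMap.ker h).subtype h (Submodule.subtype_injective _) hh
    (LinearMap.exact_subtype_ker_map h)]
  gcongr
  exact Module.length_le_of_injective (g.codRestrict (LinearMap.ker h) hgh)
    (fun a b hab => hg (congrArg Subtype.val hab))

end Length

/-! ### Filtration by powers of `f`, and convergence to the F-pure threshold -/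

section Filtration

variable {A : Type*} [CommRing A]

/-- Induction on `t` along the right exact sequence `A/(I + (f)) → A/(I + (f ^ (t+1))) → A/(I + (f ^
t)) → 0`, whose first map is multiplication by `f ^ t`. -/
theorem Ideal.length_quotient_sup_span_pow_le (I : Ideal A) (f : A) (t : ℕ) :
    Module.length A (A ⧸ (I ⊔ Ideal.span {f ^ t})) ≤
      t * Module.length A (A ⧸ (I ⊔ Ideal.span {f})) := by
  induction t with
  | zero =>
    have : Subsingleton (A ⧸ (I ⊔ Ideal.span {f ^ 0})) := by
      rw [Ideal.Quotient.subsingleton_iff]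
      simp
    simp [Module.length_eq_zero]
  | succ t ih =>
    have h1 : I ⊔ Ideal.span {f} ≤
        Submodule.comap (LinearMap.mulLeft A (f ^ t)) (I ⊔ Ideal.span {f ^ (t + 1)}) := by
      rw [sup_le_iff, Ideal.span_le]
      constructor
      · intro x hx
        exact Ideal.mul_mem_left _ _ (Ideal.mem_sup_left hx)
      · rintro _ rfl
        exact Ideal.mem_sup_right (Ideal.mem_span_singleton.2 (by rw [LinearMap.mulLeft_apply, pow_succ]))
    have h2 : I ⊔ Ideal.span {f ^ (t + 1)} ≤ I ⊔ Ideal.span {f ^ t} :=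
      sup_le_sup_left (Ideal.span_singleton_le_span_singleton.2 (pow_dvd_pow f t.le_succ)) I
    have h3 := Module.length_le_add_of_exact
      (Submodule.mapQ (I ⊔ Ideal.span {f}) (I ⊔ Ideal.span {f ^ (t + 1)})
        (LinearMap.mulLeft A (f ^ t)) h1)
      (Submodule.factor h2) (Submodule.factor_surjective h2) (by
        intro y
        obtain ⟨y, rfl⟩ := Submodule.Quotient.mk_surjective _ y
        constructor
        · intro hy
          have hy' : y ∈ I ⊔ Ideal.span {f ^ t} := by
            rwa [← Submodule.mkQ_apply, Submodule.factor_mk, Submodule.mkQ_apply,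
              Submodule.Quotient.mk_eq_zero] at hy
          obtain ⟨a, ha, b, hb, rfl⟩ := Submodule.mem_sup.1 hy'
          obtain ⟨c, rfl⟩ := Ideal.mem_span_singleton.1 hb
          refine ⟨Submodule.Quotient.mk c, ?_⟩
          rw [Submodule.mapQ_apply, LinearMap.mulLeft_apply, Submodule.Quotient.eq]
          have : f ^ t * c - (a + f ^ t * c) = -a := by ring
          rw [this]
          exact neg_mem (Ideal.mem_sup_left ha)
        · rintro ⟨c, hc⟩
          obtain ⟨c, rfl⟩ := Submodule.Quotient.mk_surjective _ c
          rw [← hc, Submodule.mapQ_apply, ← Submodule.mkQ_apply, Submodule.factor_mk,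
            Submodule.mkQ_apply, Submodule.Quotient.mk_eq_zero, LinearMap.mulLeft_apply]
          exact Ideal.mem_sup_right (Ideal.mul_mem_right _ _ (Ideal.mem_span_singleton_self _)))
    calc _ ≤ _ := h3
      _ ≤ _ := add_le_add_right ih _
      _ = _ := by push_cast; ring

theorem Ideal.length_quotient_le_of_pow_mem {I : Ideal A} {f : A} {t : ℕ} (h : f ^ t ∈ I) :
    Module.length A (A ⧸ I) ≤ t * Module.length A (A ⧸ (I ⊔ Ideal.span {f})) := by
  have := Ideal.length_quotient_sup_span_pow_le I f t
  rwa [sup_eq_left.2 ((Ideal.span_singleton_le_iff_mem I).2 h)] at this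

theorem Ideal.length_quotient_map_mk (I J : Ideal A) :
    Module.length (A ⧸ I) ((A ⧸ I) ⧸ J.map (Ideal.Quotient.mk I)) =
      Module.length A (A ⧸ (J ⊔ I)) := by
  rw [← Module.length_eq_of_surjective (S := A) (R := A ⧸ I)
    (M := (A ⧸ I) ⧸ J.map (Ideal.Quotient.mk I)) Ideal.Quotient.mk_surjective, sup_comm]
  exact (DoubleQuot.quotQuotEquivQuotSupₐ A I J).toLinearEquiv.length_eq

theorem frobeniusOrder_mem [IsLocalRing A] {f : A} (hf : f ∈ IsLocalRing.maximalIdeal A)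
    {q : ℕ} (hq : 1 ≤ q) : 1 ≤ frobeniusOrder f q ∧
      f ^ frobeniusOrder f q ∈ frobeniusPower (IsLocalRing.maximalIdeal A) q :=
  Nat.sInf_mem (s := {t : ℕ | 1 ≤ t ∧ f ^ t ∈ frobeniusPower (IsLocalRing.maximalIdeal A) q})
    ⟨q, hq, Ideal.subset_span ⟨f, hf, rfl⟩⟩

/-- Frobenius carries `f ^ t ∈ 𝔪^[q]` to `f ^ (t * p) ∈ 𝔪^[pq]`. -/
theorem frobeniusOrder_succ_le [IsLocalRing A] (p : ℕ) [Fact p.Prime] [CharP A p] {f : A}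
    (hf : f ∈ IsLocalRing.maximalIdeal A) (e : ℕ) :
    frobeniusOrder f (p ^ (e + 1)) ≤ frobeniusOrder f (p ^ e) * p := by
  have hp : 1 ≤ p := (Fact.out : p.Prime).one_le
  obtain ⟨h1, h2⟩ := frobeniusOrder_mem hf (Nat.one_le_pow e p hp)
  refine Nat.sInf_le ⟨Nat.mul_pos h1 hp, ?_⟩
  have : ExpChar A p := .prime Fact.out
  rw [frobeniusPower_eq_map_iterateFrobenius] at h2 ⊢
  have h3 : iterateFrobenius A p (e + 1) = (frobenius A p).comp (iterateFrobenius A p e) := by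
    ext x
    simp [iterateFrobenius_def, frobenius_def, pow_succ, pow_mul]
  rw [h3, ← Ideal.map_map, pow_mul]
  exact Ideal.mem_map_of_mem (frobenius A p) h2

theorem fptSeq_antitone [IsLocalRing A] (p : ℕ) [Fact p.Prime] [CharP A p] {f : A}
    (hf : f ∈ IsLocalRing.maximalIdeal A) : Antitone (fptSeq p f) := by
  refine antitone_nat_of_succ_le fun e => ?_
  have hp : (0 : ℝ) < p := by exact_mod_cast (Fact.out : p.Prime).pos
  unfold fptSeq
  rw [div_le_div_iff₀ (by positivity) (by positivity), pow_succ (p : ℝ)]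
  have : (frobeniusOrder f (p ^ (e + 1)) : ℝ) ≤ frobeniusOrder f (p ^ e) * p := by
    exact_mod_cast frobeniusOrder_succ_le p hf e
  calc _ ≤ (frobeniusOrder f (p ^ e) * p : ℝ) * p ^ e := by gcongr
    _ = _ := by ring

theorem tendsto_fptSeq [IsLocalRing A] (p : ℕ) [Fact p.Prime] [CharP A p] {f : A}
    (hf : f ∈ IsLocalRing.maximalIdeal A) : Tendsto (fptSeq p f) atTop (𝓝 (fpt p f)) :=
  tendsto_nhds_limUnder ⟨_, tendsto_atTop_ciInf (fptSeq_antitone p hf)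
    ⟨0, by rintro _ ⟨e, rfl⟩; unfold fptSeq; positivity⟩⟩

end Filtration

/-! ### Krull dimension of the hypersurface -/

section PowerSeriesDim

theorem PowerSeries.ringKrullDim_eq_add_one (A : Type*) [CommRing A] [IsLocalRing A]
    [IsNoetherianRing A] : ringKrullDim (PowerSeries A) = ringKrullDim A + 1 := by
  have hreg : (PowerSeries.X : PowerSeries A) ∈ nonZeroDivisors (PowerSeries A) :=
    MvPowerSeries.X_mem_nonzeroDivisors
  have hmem : (PowerSeries.X : PowerSeries A) ∈ IsLocalRing.maximalIdeal (PowerSeries A) := by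
    rw [IsLocalRing.mem_maximalIdeal, mem_nonunits_iff, PowerSeries.isUnit_iff_constantCoeff]
    simp
  rw [← ringKrullDim_quotient_span_singleton_succ_eq_ringKrullDim_of_mem_nonZeroDivisors hreg hmem]
  have hker : RingHom.ker (PowerSeries.constantCoeff (R := A)) = Ideal.span {PowerSeries.X} := by
    ext x
    rw [RingHom.mem_ker, Ideal.mem_span_singleton, PowerSeries.X_dvd_iff]
  rw [← hker, ringKrullDim_eq_of_ringEquiv (RingHom.quotientKerEquivOfSurjective
    (f := PowerSeries.constantCoeff (R := A)) (fun a => ⟨PowerSeries.C a, by simp⟩))]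

theorem MvPowerSeries.ringKrullDim_fin (k : Type*) [Field k] (n : ℕ) :
    ringKrullDim (MvPowerSeries (Fin n) k) = n := by
  induction n with
  | zero =>
    rw [ringKrullDim_eq_of_ringEquiv (MvPowerSeries.isEmptyEquiv (Fin 0) k).toRingEquiv]
    simp
  | succ n ih =>
    rw [ringKrullDim_eq_of_ringEquiv (MvPowerSeries.finSuccEquiv k n).toRingEquiv,
      PowerSeries.ringKrullDim_eq_add_one, ih]
    simp

theorem localDim_quotient_span_singleton {k : Type*} [Field k] {n : ℕ}
    {f : MvPowerSeries (Fin (n + 1)) k} (hf0 : f ≠ 0)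
    (hf : f ∈ IsLocalRing.maximalIdeal (MvPowerSeries (Fin (n + 1)) k))
    [IsLocalRing (MvPowerSeries (Fin (n + 1)) k ⧸ Ideal.span {f})] :
    localDim (MvPowerSeries (Fin (n + 1)) k ⧸ Ideal.span {f}) = n := by
  have h := ringKrullDim_quotient_span_singleton_succ_eq_ringKrullDim_of_mem_nonZeroDivisors
    (mem_nonZeroDivisors_of_ne_zero hf0) hf
  rw [MvPowerSeries.ringKrullDim_fin] at h
  have h2 : ringKrullDim (MvPowerSeries (Fin (n + 1)) k ⧸ Ideal.span {f}) = (n : WithBot ℕ∞) := by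
    have hn : ((n + 1 : ℕ) : WithBot ℕ∞) = n + 1 := by push_cast; rfl
    rw [hn] at h
    exact (ENat.WithBot.add_one_cancel).1 h
  unfold localDim
  rw [h2]
  rfl

end PowerSeriesDim

/-! ### Ideals generated by powers of the variables, and their colengths -/

namespace MvPowerSeries

variable {σ k : Type*} [Field k]

/-- Induction on `s`: the terms of `g` with `X j`-exponent below `q` fall under the induction
hypothesis, and the remaining terms are divisible by `X j ^ q`. -/
theorem mem_span_X_pow_of_coeff_eq_zero (q : ℕ) (s : Finset σ) (g : MvPowerSeries σ k)
    (hg : ∀ d : σ →₀ ℕ, (∀ i ∈ s, d i < q) → coeff d g = 0) :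
    g ∈ Ideal.span ((fun i => (X i : MvPowerSeries σ k) ^ q) '' (s : Set σ)) := by
  classical
  induction s using Finset.induction_on generalizing g with
  | empty =>
    have : g = 0 := by
      ext d
      simpa using hg d (by simp)
    rw [this]
    exact zero_mem _
  | insert j s hj ih =>
    let g₁ : MvPowerSeries σ k := fun d => if d j < q then coeff d g else 0
    have hg₁ : ∀ d, coeff d g₁ = if d j < q then coeff d g else 0 := fun d => rfl
    have h1 : g₁ ∈ Ideal.span ((fun i => (X i : MvPowerSeries σ k) ^ q) '' (s : Set σ)) := by
      refine ih g₁ fun d hd => ?_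
      rw [hg₁]
      split_ifs with h
      · exact hg d (by
          intro i hi
          rcases Finset.mem_insert.1 hi with rfl | hi
          exacts [h, hd i hi])
      · rfl
    have h2 : (X j : MvPowerSeries σ k) ^ q ∣ g - g₁ := by
      rw [X_pow_dvd_iff]
      intro m hm
      rw [map_sub, hg₁, if_pos hm, sub_self]
    have h3 : g = g₁ + (g - g₁) := by ring
    rw [h3]
    refine add_mem (Ideal.span_mono (Set.image_mono (by simp)) h1) ?_
    exact Ideal.mem_of_dvd _ h2 (Ideal.subset_span ⟨j, by simp, rfl⟩)

theorem mem_span_range_X_pow_iff [Finite σ] {q : ℕ} {g : MvPowerSeries σ k} :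
    g ∈ Ideal.span (Set.range fun i => (X i : MvPowerSeries σ k) ^ q) ↔
      ∀ d : σ →₀ ℕ, (∀ i, d i < q) → coeff d g = 0 := by
  classical
  cases nonempty_fintype σ
  constructor
  · intro hg d hd
    induction hg using Submodule.span_induction with
    | mem x hx =>
      obtain ⟨i, rfl⟩ := hx
      exact X_pow_dvd_iff.1 dvd_rfl d (hd i)
    | zero => simp
    | add x y _ _ hx hy => simp [hx, hy]
    | smul a x hx ih =>
      -- Vanishing of these coefficients for `x` alone says too little here, so a second induction
      -- proves it for `a • x` with `a` arbitrary.
      clear ih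
      induction hx using Submodule.span_induction generalizing a with
      | mem x hx =>
        obtain ⟨i, rfl⟩ := hx
        exact X_pow_dvd_iff.1 (Dvd.intro_left a rfl) d (hd i)
      | zero => simp
      | add x y _ _ hx hy => rw [smul_add, map_add, hx, hy, add_zero]
      | smul b x _ ih => rw [smul_smul]; exact ih _
  · intro hg
    have := mem_span_X_pow_of_coeff_eq_zero q Finset.univ g (fun d hd => hg d (by simpa using hd))
    simpa using this

theorem maximalIdeal_eq_span_range_X [Finite σ] :
    IsLocalRing.maximalIdeal (MvPowerSeries σ k) = Ideal.span (Set.range X) := by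
  ext g
  have h := mem_span_range_X_pow_iff (q := 1) (g := g)
  simp only [pow_one] at h
  rw [h, IsLocalRing.mem_maximalIdeal, mem_nonunits_iff, isUnit_iff_constantCoeff,
    isUnit_iff_ne_zero, not_not]
  constructor
  · intro h0 d hd
    have : d = 0 := by ext i; simpa using hd i
    simpa [this] using h0
  · intro h0
    simpa using h0 0 (by simp)

section CharP

variable (p : ℕ) [Fact p.Prime] [CharP k p]

instance charP : CharP (MvPowerSeries σ k) p :=
  charP_of_injective_algebraMap (FaithfulSMul.algebraMap_injective k (MvPowerSeries σ k)) p

theorem frobeniusPower_maximalIdeal [Finite σ] (e : ℕ) :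
    frobeniusPower (IsLocalRing.maximalIdeal (MvPowerSeries σ k)) (p ^ e) =
      Ideal.span (Set.range fun i => (X i : MvPowerSeries σ k) ^ p ^ e) := by
  have : ExpChar (MvPowerSeries σ k) p := .prime Fact.out
  rw [frobeniusPower_eq_map_iterateFrobenius, maximalIdeal_eq_span_range_X, Ideal.map_span,
    ← Set.range_comp]
  rfl

end CharP

/-- Every series is congruent to its constant term modulo the maximal ideal, so the residue field is
`k` and lengths become `k`-dimensions. -/
theorem length_eq_length_field {σ : Type*} (M : Type*) [AddCommGroup M] [Module k M]
    [Module (MvPowerSeries σ k) M] [IsScalarTower k (MvPowerSeries σ k) M] :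
    Module.length (MvPowerSeries σ k) M = Module.length k M := by
  have hloc : IsLocalHom (algebraMap k (MvPowerSeries σ k)) := inferInstance
  rw [IsLocalRing.length_restrictScalars k (MvPowerSeries σ k) M]
  have hsurj : Function.Surjective (algebraMap (IsLocalRing.ResidueField k)
      (IsLocalRing.ResidueField (MvPowerSeries σ k))) := by
    intro y
    obtain ⟨g, rfl⟩ := IsLocalRing.residue_surjective y
    refine ⟨IsLocalRing.residue k (constantCoeff g), ?_⟩
    rw [IsLocalRing.ResidueField.algebraMap_residue, ← sub_eq_zero, ← map_sub,
      IsLocalRing.residue_eq_zero_iff, IsLocalRing.mem_maximalIdeal, mem_nonunits_iff,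
      isUnit_iff_constantCoeff]
    simp [algebraMap_apply]
  rw [Module.length_eq_of_surjective (M := IsLocalRing.ResidueField (MvPowerSeries σ k)) hsurj,
    Module.length_eq_one (IsLocalRing.ResidueField (MvPowerSeries σ k))
      (IsLocalRing.ResidueField (MvPowerSeries σ k)), mul_one]

/-! ### Boxes of monomials and the upper bound on colength -/

section Box

variable [Fintype σ]

/-- The coefficients of the monomials all of whose exponents are less than `q`. -/
noncomputable def boxCoeff (q : ℕ) : MvPowerSeries σ k →ₗ[k] ((σ → Fin q) → k) :=
  LinearMap.pi fun b => coeff (Finsupp.equivFunOnFinite.symm fun i => (b i : ℕ))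

/-- The power series with the given coefficients at the monomials all of whose exponents are less
than `q`, and zero coefficients elsewhere. -/
noncomputable def ofBox (q : ℕ) : ((σ → Fin q) → k) →ₗ[k] MvPowerSeries σ k :=
  LinearMap.pi (φ := fun _ : σ →₀ ℕ => k) fun d =>
    if h : ∀ i, d i < q then LinearMap.proj fun i => ⟨d i, h i⟩ else 0

theorem coeff_ofBox (q : ℕ) (v : (σ → Fin q) → k) (d : σ →₀ ℕ) :
    coeff d (ofBox q v) = if h : ∀ i, d i < q then v fun i => ⟨d i, h i⟩ else 0 := by
  change (if h : ∀ i, d i < q then LinearMap.proj fun i => ⟨d i, h i⟩ else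
    (0 : ((σ → Fin q) → k) →ₗ[k] k)) v = _
  split_ifs <;> rfl

theorem boxCoeff_ofBox (q : ℕ) (v : (σ → Fin q) → k) : boxCoeff q (ofBox q v) = v := by
  ext b
  simp [boxCoeff, coeff_ofBox]

theorem ker_boxCoeff (q : ℕ) : LinearMap.ker (boxCoeff (σ := σ) (k := k) q) =
    (Ideal.span (Set.range fun i => (X i : MvPowerSeries σ k) ^ q)).restrictScalars k := by
  ext g
  rw [Submodule.restrictScalars_mem, mem_span_range_X_pow_iff, LinearMap.mem_ker, funext_iff]
  constructor
  · intro h d hd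
    have := h fun i => ⟨d i, hd i⟩
    simpa [boxCoeff] using this
  · intro h b
    exact h _ (by simp)

theorem length_quotient_span_X_pow (q : ℕ) :
    Module.length k (MvPowerSeries σ k ⧸
      Ideal.span (Set.range fun i => (X i : MvPowerSeries σ k) ^ q)) =
      (q ^ Fintype.card σ : ℕ) := by
  classical
  have e := LinearMap.quotKerEquivOfSurjective (boxCoeff (σ := σ) (k := k) q)
    (fun v => ⟨_, boxCoeff_ofBox q v⟩)
  rw [ker_boxCoeff] at e
  have e' := (Submodule.Quotient.restrictScalarsEquiv k
    (Ideal.span (Set.range fun i => (X i : MvPowerSeries σ k) ^ q))).symm.trans e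
  rw [e'.length_eq, Module.length_eq_finrank, Module.finrank_pi, Fintype.card_fun,
    Fintype.card_fin]

/-- Let `d` be the lexicographic leading exponent of `f` and `a` its degree. Multiplication by `f`
embeds the series supported in the box of side `q - a` into the quotient by the `q`-th powers:
leading exponents add, so that of the product stays in the box of side `q`. The image dies modulo
`f`. -/
theorem length_quotient_sup_span_add_le [LinearOrder σ] {f : MvPowerSeries σ k} (hf : f ≠ 0) :
    ∃ a : ℕ, ∀ q : ℕ, ((q - a) ^ Fintype.card σ : ℕ) + Module.length k (MvPowerSeries σ k ⧸
      (Ideal.span (Set.range fun i => (X i : MvPowerSeries σ k) ^ q) ⊔ Ideal.span {f})) ≤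
      (q ^ Fintype.card σ : ℕ) := by
  classical
  obtain ⟨d, hd⟩ := exists_finsupp_eq_lexOrder_of_ne_zero hf
  refine ⟨d.degree, fun q => ?_⟩
  set J := Ideal.span (Set.range fun i => (X i : MvPowerSeries σ k) ^ q)
  have hV : Module.length k ((σ → Fin (q - d.degree)) → k) =
      ((q - d.degree) ^ Fintype.card σ : ℕ) := by
    rw [Module.length_eq_finrank, Module.finrank_pi, Fintype.card_fun, Fintype.card_fin]
  rw [← length_quotient_span_X_pow (k := k) q, ← hV]
  have hle : J ≤ J ⊔ Ideal.span {f} := le_sup_left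
  refine Module.length_add_le_of_comp_eq_zero
    (((Submodule.mkQ J).restrictScalars k) ∘ₗ LinearMap.mulLeft k f ∘ₗ ofBox (q - d.degree))
    ((Submodule.factor hle).restrictScalars k) ?_ (Submodule.factor_surjective hle) ?_
  · rw [← LinearMap.ker_eq_bot, LinearMap.ker_eq_bot']
    intro v hv
    have hv' : f * ofBox (q - d.degree) v ∈ J := (Submodule.Quotient.mk_eq_zero J).1 hv
    by_contra hv0
    have hb0 : ofBox (q - d.degree) v ≠ 0 := fun h => hv0 (by
      rw [← boxCoeff_ofBox (q - d.degree) v, h, map_zero])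
    obtain ⟨b, hb⟩ := exists_finsupp_eq_lexOrder_of_ne_zero hb0
    have hbc := coeff_ne_zero_of_lexOrder hb.symm
    have hbq : ∀ i, b i < q - d.degree := by
      by_contra h
      rw [coeff_ofBox, dif_neg h] at hbc
      exact hbc rfl
    have h1 := coeff_mul_of_add_lexOrder hd hb
    -- Each `d i + b i` is below `q`, so membership in `J` kills the coefficient at `d + b`, which
    -- is the product of two nonzero leading coefficients.
    rw [mem_span_range_X_pow_iff.1 hv' (d + b) fun i => by
      have h2 := hbq i
      have h3 := Finsupp.le_degree i d
      rw [Finsupp.add_apply]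
      omega] at h1
    exact mul_ne_zero (coeff_ne_zero_of_lexOrder hd.symm) hbc h1.symm
  · intro v
    change Submodule.factor hle (Submodule.mkQ J (f * ofBox (q - d.degree) v)) = 0
    rw [Submodule.factor_mk, Submodule.mkQ_apply, Submodule.Quotient.mk_eq_zero]
    exact Ideal.mem_sup_right (Ideal.mul_mem_right _ _ (Ideal.mem_span_singleton_self f))

end Box

end MvPowerSeries

/-! ### Frobenius and Cartier operators over a perfect field -/

namespace MvPowerSeries

variable {σ k : Type*} [Field k] (p : ℕ) [Fact p.Prime] [CharP k p]

section Coeff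

theorem coeff_smul_pow_char (r : MvPowerSeries σ k) (d : σ →₀ ℕ) :
    coeff (p • d) (r ^ p) = coeff d r ^ p := by
  have : ExpChar k p := .prime Fact.out
  have hp : p ≠ 0 := (Fact.out : p.Prime).ne_zero
  rw [← map_frobenius_expand p hp, coeff_map, coeff_expand_smul, frobenius_def]

theorem exists_eq_smul_of_coeff_pow_char_ne_zero {r : MvPowerSeries σ k} {u : σ →₀ ℕ}
    (h : coeff u (r ^ p) ≠ 0) : ∃ d : σ →₀ ℕ, u = p • d := by
  have : ExpChar k p := .prime Fact.out
  have hp : p ≠ 0 := (Fact.out : p.Prime).ne_zero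
  have hdvd : ∀ i, p ∣ u i := by
    by_contra! hi
    obtain ⟨i, hi⟩ := hi
    rw [← map_frobenius_expand p hp, coeff_map, coeff_expand_of_not_dvd p hp _ hi, map_zero] at h
    exact h rfl
  refine ⟨u.mapRange (fun a => a / p) (by simp), ?_⟩
  ext i
  simp [Nat.mul_div_cancel' (hdvd i)]

end Coeff

section FrobeniusSum

variable [Fintype σ] [DecidableEq σ]

/-- The exponent vector of a monomial in the basis over the subring of `p`-th powers. -/
noncomputable def exponent {p : ℕ} (b : σ → Fin p) : σ →₀ ℕ :=
  Finsupp.equivFunOnFinite.symm fun i => (b i : ℕ)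

/-- The additive map sending a family `(g b)` of residue classes modulo `I` to the residue class of
`∑ b, X ^ b * g b ^ p` modulo the Frobenius power of `I`. -/
noncomputable def frobeniusSum (I : Ideal (MvPowerSeries σ k)) :
    ((σ → Fin p) → MvPowerSeries σ k ⧸ I) →+
      MvPowerSeries σ k ⧸ I.map (frobenius (MvPowerSeries σ k) p) :=
  ∑ b, ((AddMonoidHom.mulLeft (Ideal.Quotient.mk _ (monomial (exponent b) (1 : k)))).comp
    (Ideal.quotientMap (I.map (frobenius (MvPowerSeries σ k) p)) (frobenius (MvPowerSeries σ k) p)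
      Ideal.le_comap_map).toAddMonoidHom).comp (Pi.evalAddMonoidHom _ b)

theorem frobeniusSum_mk (I : Ideal (MvPowerSeries σ k)) (g : (σ → Fin p) → MvPowerSeries σ k) :
    frobeniusSum p I (fun b => Ideal.Quotient.mk I (g b)) =
      Ideal.Quotient.mk _ (∑ b, g b ^ p * monomial (exponent b) (1 : k)) := by
  simp [frobeniusSum, AddMonoidHom.finsetSum_apply, frobenius_def, mul_comm]

end FrobeniusSum

variable [PerfectRing k p]

/-- The `p`-th root of the coefficient of the monomial `X ^ c` with respect to the expansion of a
power series as a linear combination of monomials over the subring of `p`-th powers. -/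
noncomputable def cartier (c : σ →₀ ℕ) : MvPowerSeries σ k →+ MvPowerSeries σ k where
  toFun g := fun d => (frobeniusEquiv k p).symm (coeff (p • d + c) g)
  map_zero' := by
    ext d
    change (frobeniusEquiv k p).symm _ = 0
    simp
  map_add' g h := by
    ext d
    change (frobeniusEquiv k p).symm _ = (frobeniusEquiv k p).symm _ + (frobeniusEquiv k p).symm _
    simp

theorem coeff_cartier (c d : σ →₀ ℕ) (g : MvPowerSeries σ k) :
    coeff d (cartier p c g) = (frobeniusEquiv k p).symm (coeff (p • d + c) g) := rfl

/-- `r ^ p` is supported on exponents `p • x`. When `p • x + v = p • d + c` with `c` below `p`,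
necessarily `x ≤ d` and `v = p • (d - x) + c`, so the two convolution sums match term by term. -/
theorem cartier_pow_mul {c : σ →₀ ℕ} (hc : ∀ i, c i < p) (r s : MvPowerSeries σ k) :
    cartier p c (r ^ p * s) = r * cartier p c s := by
  classical
  have hp : 0 < p := (Fact.out : p.Prime).pos
  ext d
  rw [coeff_cartier, coeff_mul, coeff_mul, map_sum]
  symm
  refine Finset.sum_of_injOn (fun x => (p • x.1, p • x.2 + c)) ?_ ?_ ?_ ?_
  · rintro ⟨x, y⟩ _ ⟨x', y'⟩ _ h
    simp only [Prod.mk.injEq, add_left_inj] at h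
    ext i
    · have := DFunLike.congr_fun h.1 i
      simpa [hp.ne'] using this
    · have := DFunLike.congr_fun h.2 i
      simpa [hp.ne'] using this
  · rintro ⟨x, y⟩ h
    simp only [Finset.mem_coe, Finset.HasAntidiagonal.mem_antidiagonal] at h ⊢
    rw [← h, smul_add, add_assoc]
  · rintro ⟨u, v⟩ h hn
    rw [Finset.HasAntidiagonal.mem_antidiagonal] at h
    by_contra h0
    have hu : coeff u (r ^ p) ≠ 0 := by
      intro hu
      simp [hu] at h0
    obtain ⟨x, rfl⟩ := exists_eq_smul_of_coeff_pow_char_ne_zero p hu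
    -- From `p * x i ≤ p * d i + c i < p * (d i + 1)`.
    have hxd : ∀ i, x i ≤ d i := by
      intro i
      have h1 := DFunLike.congr_fun h i
      simp only [Finsupp.add_apply, Finsupp.smul_apply, smul_eq_mul] at h1
      by_contra! h2
      have h3 : p * (d i + 1) ≤ p * x i := Nat.mul_le_mul_left p h2
      have h4 := hc i
      rw [mul_add, mul_one] at h3
      omega
    refine hn ⟨(x, d - x), ?_, ?_⟩
    · simpa using add_tsub_cancel_of_le (show x ≤ d from hxd)
    · have h5 : p • x + (p • (d - x) + c) = p • x + v := by
        rw [h, ← add_assoc, ← smul_add, add_tsub_cancel_of_le (show x ≤ d from hxd)]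
      exact Prod.ext rfl (add_left_cancel h5)
  · rintro ⟨x, y⟩ _
    simp only
    rw [coeff_smul_pow_char, map_mul, coeff_cartier, ← frobenius_def, frobeniusEquiv_symm_apply_frobenius]

theorem cartier_monomial [DecidableEq σ] {c c' : σ →₀ ℕ} (hc' : ∀ i, c' i < p) :
    cartier p c (monomial c' (1 : k)) = if c = c' then 1 else 0 := by
  have hp : 0 < p := (Fact.out : p.Prime).pos
  ext d
  rw [coeff_cartier, coeff_monomial]
  by_cases h : p • d + c = c'
  · have hd : d = 0 := by
      ext i
      have h1 := DFunLike.congr_fun h i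
      simp only [Finsupp.add_apply, Finsupp.smul_apply, smul_eq_mul] at h1
      by_contra h2
      have h3 : p * 1 ≤ p * d i := Nat.mul_le_mul_left p (Nat.pos_of_ne_zero h2)
      have h4 := hc' i
      omega
    subst hd
    simp at h
    simp [h]
  · rw [if_neg h, map_zero]
    split_ifs with h1
    · have hd : d ≠ 0 := by
        rintro rfl
        exact h (by simpa using h1)
      rw [coeff_one, if_neg hd]
    · simp

/-- By `cartier_pow_mul`, any multiple of a generator `y ^ p` is sent to a multiple of `y`. -/
theorem cartier_mem {c : σ →₀ ℕ} (hc : ∀ i, c i < p) {I : Ideal (MvPowerSeries σ k)}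
    {g : MvPowerSeries σ k} (hg : g ∈ I.map (frobenius (MvPowerSeries σ k) p)) :
    cartier p c g ∈ I := by
  induction hg using Submodule.span_induction with
  | mem x hx =>
    obtain ⟨y, hy, rfl⟩ := hx
    have := cartier_pow_mul p hc y 1
    rw [mul_one] at this
    rw [frobenius_def, this]
    exact I.mul_mem_right _ hy
  | zero => simp
  | add x y _ _ hx hy => rw [map_add]; exact add_mem hx hy
  | smul a x hx ih =>
    clear ih
    induction hx using Submodule.span_induction generalizing a with
    | mem x hx =>
      obtain ⟨y, hy, rfl⟩ := hx
      rw [smul_eq_mul, mul_comm, frobenius_def, cartier_pow_mul p hc]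
      exact I.mul_mem_right _ hy
    | zero => simp
    | add x y _ _ hx hy => rw [smul_add, map_add]; exact add_mem (hx a) (hy a)
    | smul b x _ ih => rw [smul_smul]; exact ih _

variable [Fintype σ] [DecidableEq σ]

/-- Applying `cartier` at the exponent `b` to `∑ b', r b' ^ p * X ^ b'` isolates `r b`; if the sum
lies in the Frobenius power of `I`, then `cartier_mem` puts each `r b` in `I`. -/
theorem frobeniusSum_injective (I : Ideal (MvPowerSeries σ k)) :
    Function.Injective (frobeniusSum p I) := by
  rw [injective_iff_map_eq_zero]
  intro g hg
  choose r hr using fun b => Ideal.Quotient.mk_surjective (g b)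
  obtain rfl : (fun b => Ideal.Quotient.mk I (r b)) = g := funext hr
  rw [frobeniusSum_mk, Ideal.Quotient.eq_zero_iff_mem] at hg
  have hexp : ∀ (b : σ → Fin p) i, exponent b i < p := fun b i => by simp [exponent]
  have hinj : ∀ b b' : σ → Fin p, exponent b = exponent b' ↔ b = b' := fun b b' => by
    constructor
    · intro h
      ext i
      simpa [exponent] using DFunLike.congr_fun h i
    · rintro rfl
      rfl
  funext b
  have h := cartier_mem p (hexp b) hg
  rw [map_sum, Finset.sum_congr rfl (fun b' _ => by
    rw [cartier_pow_mul p (hexp b), cartier_monomial p (hexp b')])] at h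
  simp only [hinj, mul_ite, mul_one, mul_zero, Finset.sum_ite_eq, Finset.mem_univ, if_true] at h
  exact Ideal.Quotient.eq_zero_iff_mem.2 h

/-- The half of flatness of Frobenius that is needed. `frobeniusSum` is injective and semilinear
over the Frobenius of `k`, which is bijective as `k` is perfect, so it compares dimensions. -/
theorem pow_card_mul_length_le (I : Ideal (MvPowerSeries σ k)) :
    (p ^ Fintype.card σ : ℕ) * Module.length k (MvPowerSeries σ k ⧸ I) ≤
      Module.length k (MvPowerSeries σ k ⧸ I.map (frobenius (MvPowerSeries σ k) p)) := by
  have h := Module.length_pi_of_fintype (R := k) (fun _ : σ → Fin p => MvPowerSeries σ k ⧸ I)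
  rw [Finset.sum_const, Finset.card_univ, Fintype.card_fun, Fintype.card_fin, nsmul_eq_mul] at h
  rw [← h, Module.length_eq_rank, Module.length_eq_rank]
  refine Cardinal.toENat.monotone' (rank_le_of_surjective_injective (frobenius k p)
    (frobeniusSum p I) (frobeniusEquiv k p).surjective (frobeniusSum_injective p I) ?_)
  intro a g
  choose r hr using fun b => Ideal.Quotient.mk_surjective (g b)
  obtain rfl : (fun b => Ideal.Quotient.mk I (r b)) = g := funext hr
  have h1 : a • (fun b => Ideal.Quotient.mk I (r b)) = fun b => Ideal.Quotient.mk I (a • r b) :=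
    rfl
  have h2 : frobenius k p a • (Ideal.Quotient.mk (I.map (frobenius (MvPowerSeries σ k) p))
      (∑ b, r b ^ p * monomial (exponent b) (1 : k))) = Ideal.Quotient.mk _
      (frobenius k p a • ∑ b, r b ^ p * monomial (exponent b) (1 : k)) := rfl
  rw [h1, frobeniusSum_mk, frobeniusSum_mk, h2, Finset.smul_sum]
  simp only [smul_pow, frobenius_def, smul_mul_assoc]

end MvPowerSeries

/-! ### Hilbert–Kunz numbers: monotonicity, boundedness, comparison with `μ_f` -/

namespace MvPowerSeries

variable {k : Type*} [Field k] (p : ℕ) {n : ℕ}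

/-- The length of `k⟦X₁, …, Xₙ₊₁⟧ / (f)` modulo the `p ^ e`-th powers of the variables. -/
noncomputable def hilbertKunzLength (f : MvPowerSeries (Fin (n + 1)) k) (e : ℕ) : ℕ :=
  (Module.length k (MvPowerSeries (Fin (n + 1)) k ⧸
    (Ideal.span (Set.range fun i => (X i : MvPowerSeries (Fin (n + 1)) k) ^ p ^ e) ⊔
      Ideal.span {f}))).toNat

variable {f : MvPowerSeries (Fin (n + 1)) k}

theorem coe_hilbertKunzLength (hf0 : f ≠ 0) (e : ℕ) : (hilbertKunzLength p f e : ℕ∞) =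
    Module.length k (MvPowerSeries (Fin (n + 1)) k ⧸
      (Ideal.span (Set.range fun i => (X i : MvPowerSeries (Fin (n + 1)) k) ^ p ^ e) ⊔
        Ideal.span {f})) := by
  obtain ⟨a, ha⟩ := length_quotient_sup_span_add_le hf0
  exact ENat.natCast_toNat (ne_top_of_le_ne_top (ENat.natCast_ne_top _) (le_add_self.trans (ha (p ^ e))))

theorem exists_hilbertKunzLength_le (hf0 : f ≠ 0) :
    ∃ a : ℕ, ∀ e, hilbertKunzLength p f e + (p ^ e - a) ^ (n + 1) ≤ (p ^ e) ^ (n + 1) := by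
  obtain ⟨a, ha⟩ := length_quotient_sup_span_add_le hf0
  refine ⟨a, fun e => ?_⟩
  have h := ha (p ^ e)
  rw [← coe_hilbertKunzLength p hf0, add_comm, Fintype.card_fin] at h
  exact_mod_cast h

variable [Fact p.Prime] [CharP k p]

theorem pow_mul_hilbertKunzLength_le [PerfectRing k p] (hf0 : f ≠ 0) (e : ℕ) :
    p ^ (n + 1) * hilbertKunzLength p f e ≤ p * hilbertKunzLength p f (e + 1) := by
  have h1 := pow_card_mul_length_le p
    (Ideal.span (Set.range fun i => (X i : MvPowerSeries (Fin (n + 1)) k) ^ p ^ e) ⊔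
      Ideal.span {f})
  have h2 := Ideal.length_quotient_sup_span_pow_le
    (Ideal.span (Set.range fun i => (X i : MvPowerSeries (Fin (n + 1)) k) ^ p ^ (e + 1))) f p
  have h3 : Ideal.map (frobenius (MvPowerSeries (Fin (n + 1)) k) p)
      (Ideal.span (Set.range fun i => (X i : MvPowerSeries (Fin (n + 1)) k) ^ p ^ e) ⊔
        Ideal.span {f}) =
      Ideal.span (Set.range fun i => (X i : MvPowerSeries (Fin (n + 1)) k) ^ p ^ (e + 1)) ⊔
        Ideal.span {f ^ p} := by
    rw [Ideal.map_sup, Ideal.map_span, Ideal.map_span, ← Set.range_comp, Set.image_singleton]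
    simp only [Function.comp_def, frobenius_def, ← pow_mul, ← pow_succ]
  rw [length_eq_length_field, length_eq_length_field, ← h3, ← coe_hilbertKunzLength p hf0] at h2
  rw [← coe_hilbertKunzLength p hf0, Fintype.card_fin] at h1
  exact_mod_cast h1.trans h2

theorem pow_le_frobeniusOrder_mul_hilbertKunzLength (hf0 : f ≠ 0)
    (hf : f ∈ IsLocalRing.maximalIdeal (MvPowerSeries (Fin (n + 1)) k)) (e : ℕ) :
    (p ^ e) ^ (n + 1) ≤ frobeniusOrder f (p ^ e) * hilbertKunzLength p f e := by
  have h := (frobeniusOrder_mem hf (Nat.one_le_pow e p (Fact.out : p.Prime).pos)).2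
  rw [frobeniusPower_maximalIdeal] at h
  have h1 := Ideal.length_quotient_le_of_pow_mem h
  rw [length_eq_length_field, length_eq_length_field, length_quotient_span_X_pow,
    ← coe_hilbertKunzLength p hf0, Fintype.card_fin] at h1
  exact_mod_cast h1

theorem hilbertKunzSeq_quotient_span_singleton (hf0 : f ≠ 0)
    (hf : f ∈ IsLocalRing.maximalIdeal (MvPowerSeries (Fin (n + 1)) k))
    [IsLocalRing (MvPowerSeries (Fin (n + 1)) k ⧸ Ideal.span {f})] (e : ℕ) :
    hilbertKunzSeq p (MvPowerSeries (Fin (n + 1)) k ⧸ Ideal.span {f}) e =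
      hilbertKunzLength p f e / (p : ℝ) ^ (e * n) := by
  unfold hilbertKunzSeq
  rw [localDim_quotient_span_singleton hf0 hf,
    ← IsLocalRing.map_maximalIdeal_of_surjective (Ideal.Quotient.mk (Ideal.span {f}))
      Ideal.Quotient.mk_surjective,
    frobeniusPower_map_of_surjective Ideal.Quotient.mk_surjective, Ideal.length_quotient_map_mk,
    frobeniusPower_maximalIdeal, length_eq_length_field]
  rfl

variable (hf0 : f ≠ 0) (hf : f ∈ IsLocalRing.maximalIdeal (MvPowerSeries (Fin (n + 1)) k))
  [IsLocalRing (MvPowerSeries (Fin (n + 1)) k ⧸ Ideal.span {f})]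

include hf0 hf in
theorem hilbertKunzSeq_monotone [PerfectRing k p] :
    Monotone (hilbertKunzSeq p (MvPowerSeries (Fin (n + 1)) k ⧸ Ideal.span {f})) := by
  refine monotone_nat_of_le_succ fun e => ?_
  have hp : (0 : ℝ) < p := by exact_mod_cast (Fact.out : p.Prime).pos
  rw [hilbertKunzSeq_quotient_span_singleton p hf0 hf, hilbertKunzSeq_quotient_span_singleton p hf0 hf,
    div_le_div_iff₀ (by positivity) (by positivity)]
  have h : (p : ℝ) ^ (n + 1) * hilbertKunzLength p f e ≤ p * hilbertKunzLength p f (e + 1) := by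
    exact_mod_cast pow_mul_hilbertKunzLength_le p hf0 e
  rw [pow_succ', mul_assoc, mul_le_mul_iff_right₀ hp] at h
  calc (hilbertKunzLength p f e : ℝ) * p ^ ((e + 1) * n)
      = (p ^ n * hilbertKunzLength p f e) * p ^ (e * n) := by ring
    _ ≤ _ := by gcongr

include hf0 hf in
theorem bddAbove_range_hilbertKunzSeq :
    BddAbove (Set.range
      (hilbertKunzSeq p (MvPowerSeries (Fin (n + 1)) k ⧸ Ideal.span {f}))) := by
  obtain ⟨a, ha⟩ := exists_hilbertKunzLength_le p hf0
  -- The constant is the Bernoulli bound `q ^ (n+1) - (q - a) ^ (n+1) ≤ (n+1) * a * q ^ n`.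
  refine ⟨(n + 1) * a, ?_⟩
  rintro _ ⟨e, rfl⟩
  have hp : (0 : ℝ) < p := by exact_mod_cast (Fact.out : p.Prime).pos
  set q : ℝ := (p : ℝ) ^ e with hqdef
  have hq : 0 < q := by positivity
  rw [hilbertKunzSeq_quotient_span_singleton p hf0 hf, div_le_iff₀ (by positivity), pow_mul, ← hqdef]
  have h1 : (hilbertKunzLength p f e : ℝ) + ((p ^ e - a : ℕ) : ℝ) ^ (n + 1) ≤ q ^ (n + 1) := by
    rw [hqdef]
    exact_mod_cast ha e
  have h2 : q ^ (n + 1) - (n + 1) * a * q ^ n ≤ ((p ^ e - a : ℕ) : ℝ) ^ (n + 1) := by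
    rcases le_total a (p ^ e) with hle | hle
    · rw [Nat.cast_sub hle, Nat.cast_pow, ← hqdef]
      have hle' : (a : ℝ) ≤ q := by rw [hqdef]; exact_mod_cast hle
      have h3 := one_add_mul_le_pow (a := -(a / q)) (by
        have : (a : ℝ) / q ≤ 1 := (div_le_one hq).2 hle'
        linarith) (n + 1)
      have h4 : q - a = q * (1 + -(a / q)) := by field_simp; ring
      rw [h4, mul_pow]
      calc q ^ (n + 1) - (n + 1) * a * q ^ n
          = q ^ (n + 1) * (1 + ((n + 1 : ℕ) : ℝ) * -(a / q)) := by
            push_cast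
            field_simp
            ring
        _ ≤ _ := by gcongr
    -- Here the truncated difference is zero, and the left side is already nonpositive because `q ≤
    -- a ≤ (n+1) * a`.
    · have hle' : q ≤ a := by rw [hqdef]; exact_mod_cast hle
      have h3 : q ^ (n + 1) ≤ (n + 1) * a * q ^ n := by
        rw [pow_succ']
        gcongr
        have : (0 : ℝ) ≤ n * a := by positivity
        linarith
      have : (0 : ℝ) ≤ ((p ^ e - a : ℕ) : ℝ) ^ (n + 1) := by positivity
      linarith
  linarith

include hf0 hf in
theorem one_le_hilbertKunzSeq_mul_fptSeq (e : ℕ) :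
    1 ≤ hilbertKunzSeq p (MvPowerSeries (Fin (n + 1)) k ⧸ Ideal.span {f}) e * fptSeq p f e := by
  have hp : (0 : ℝ) < p := by exact_mod_cast (Fact.out : p.Prime).pos
  rw [hilbertKunzSeq_quotient_span_singleton p hf0 hf, fptSeq, div_mul_div_comm,
    one_le_div (by positivity)]
  have h : ((p : ℝ) ^ e) ^ (n + 1) ≤ frobeniusOrder f (p ^ e) * hilbertKunzLength p f e := by
    exact_mod_cast pow_le_frobeniusOrder_mul_hilbertKunzLength p hf0 hf e
  calc (p : ℝ) ^ (e * n) * p ^ e = ((p : ℝ) ^ e) ^ (n + 1) := by ring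
    _ ≤ _ := h
    _ = _ := mul_comm _ _

end MvPowerSeries

theorem corollary1p8 (p : ℕ) [Fact p.Prime] (k : Type*) [Field k] [CharP k p] [PerfectField k]
    (n : ℕ) (hn : 1 ≤ n) (f : MvPowerSeries (Fin (n + 1)) k) (hf0 : f ≠ 0)
    (hf : f ∈ IsLocalRing.maximalIdeal (MvPowerSeries (Fin (n + 1)) k)) :
    haveI : IsLocalRing (MvPowerSeries (Fin (n + 1)) k ⧸ Ideal.span {f}) :=
      isLocalRing_quotient_span_singleton hf
    Tendsto (hilbertKunzSeq p (MvPowerSeries (Fin (n + 1)) k ⧸ Ideal.span {f})) atTop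
      (𝓝 (hilbertKunzMultiplicity p (MvPowerSeries (Fin (n + 1)) k ⧸ Ideal.span {f}))) ∧
    Tendsto (fptSeq p f) atTop (𝓝 (fpt p f)) ∧
    1 ≤ hilbertKunzMultiplicity p (MvPowerSeries (Fin (n + 1)) k ⧸ Ideal.span {f}) *
      fpt p f := by
  have hloc : IsLocalRing (MvPowerSeries (Fin (n + 1)) k ⧸ Ideal.span {f}) :=
    isLocalRing_quotient_span_singleton hf
  have : ExpChar k p := .prime Fact.out
  have h1 : Tendsto (hilbertKunzSeq p (MvPowerSeries (Fin (n + 1)) k ⧸ Ideal.span {f})) atTop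
      (𝓝 (hilbertKunzMultiplicity p (MvPowerSeries (Fin (n + 1)) k ⧸ Ideal.span {f}))) :=
    tendsto_nhds_limUnder ⟨_, tendsto_atTop_ciSup
      (MvPowerSeries.hilbertKunzSeq_monotone p hf0 hf)
      (MvPowerSeries.bddAbove_range_hilbertKunzSeq p hf0 hf)⟩
  have h2 := tendsto_fptSeq p hf
  exact ⟨h1, h2, ge_of_tendsto' (h1.mul h2)
    (MvPowerSeries.one_le_hilbertKunzSeq_mul_fptSeq p hf0 hf)⟩
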